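/- Let $(M,g)$ be an $n$-dimensional Riemannian spin manifold with a fixed spin structure, let $\Sigma_gM$ be its complex spinor bundle, associated to an irreducible complex representation of the Clifford algebra of $\mathbb R^n$ (with the convention $X\cdot X\cdot\psi=-g(X,X)\psi$), and let $\nabla$ denote the Levi-Civita connection and the induced spinor connection. In the following $(e_1,\dots,e_n)$ is a local orthonormal frame. For a smooth section $h$ of $\bigodot^2T^*M$ (a smooth symmetric bilinear form) and a smooth spinor $\phi\in\Gamma(\Sigma_gM)$ let $$\mathcal W_{g,\phi}(h)(X)=\sum_{j=1}^n h(X,e_j)\,e_j\cdot\phi,\qquad \kappa_{g,\phi}(h)(X)=\tfrac14\sum_{i\neq j}(\nabla_{e_i}h)(X,e_j)\,e_i\cdot e_j\cdot\phi,$$ $$(\operatorname{div}^gh)(X)=-\sum_{i=1}^n(\nabla_{e_i}h)(X,e_i),\qquad g(h^\#(X),Y)=h(Y,X),\qquad D^g\phi=\sum_{i=1}^ne_i\cdot\nabla_{e_i}\phi,$$ and let $D^{T^*M}A=\sum_{i=1}^ne_i\cdot\nabla_{e_i}A$ be the Dirac operator on sections $A$ of $\Sigma_gM\otimes T^*M$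 defined by the product connection $(\nabla_vA)(X)=\nabla_v(A(X))-A(\nabla_vX)$. (i) For all such $h$ and $\phi$ and every tangent vector $X$, $$D^{T^*M}\big(\mathcal W_{g,\phi}(h)\big)(X)=4\kappa_{g,\phi}(h)(X)+(\operatorname{div}^gh)(X)\,\phi-2\nabla_{h^\#(X)}\phi-h^\#(X)\cdot D^g\phi.$$ (ii) If $\phi$ is parallel, i.e. $\nabla\phi=0$, then $D^{T^*M}\circ\mathcal W_{g,\phi}(h)=4\kappa_{g,\phi}(h)+\phi\otimes\operatorname{div}^g(h)$ for all such $h$. -/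

import Mathlib

open Bundle Manifold FiberBundle
open scoped ContDiff Topology

noncomputable section

namespace SpinGeometry

/-! ### Clifford algebra and spinor modules -/

/-- The quadratic form `v ↦ -|v|²` on `ℝⁿ`; its Clifford algebra has the relations
`v · w + w · v = -2 ⟨v, w⟩`. -/
abbrev quadForm (n : ℕ) : QuadraticForm ℝ (Fin n → ℝ) :=
  QuadraticMap.weightedSumSquares ℝ (fun _ : Fin n => (-1 : ℝ))

/-- The real Clifford algebra of Euclidean `ℝⁿ`. -/
abbrev Cl (n : ℕ) : Type := CliffordAlgebra (quadForm n)

/-- The canonical basis vector `Eᵢ` of `ℝⁿ` inside the Clifford algebra. -/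
def clBasis (n : ℕ) (i : Fin n) : Cl n := CliffordAlgebra.ι (quadForm n) (Pi.single i 1)

/-- The group `Spin(n)`. -/
abbrev SpinGrp (n : ℕ) : Type := spinGroup (quadForm n)

/-- An irreducible complex representation of the Clifford algebra of `ℝⁿ` (equivalently of its
complexification) on the complex vector space `S`. For even `n` there is one such
representation up to isomorphism, for odd `n` there are two, and both are allowed. -/
structure SpinorModule (n : ℕ) (S : Type*) [NormedAddCommGroup S] [NormedSpace ℂ S] where
  /-- The representation. -/
  rep : Cl n →ₐ[ℝ] Module.End ℂ S
  nontrivial : Nontrivial S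
  irreducible : ∀ W : Submodule ℂ S, (∀ (c : Cl n), ∀ w ∈ W, rep c w ∈ W) → W = ⊥ ∨ W = ⊤

namespace SpinorModule

variable {n : ℕ} {S : Type*} [NormedAddCommGroup S] [NormedSpace ℂ S] [FiniteDimensional ℂ S]

/-- The action of a Clifford algebra element as a continuous real linear map. -/
def act (ρ : SpinorModule n S) (c : Cl n) : S →L[ℝ] S :=
  LinearMap.toContinuousLinearMap ((ρ.rep c).restrictScalars ℝ)

@[simp] theorem act_apply (ρ : SpinorModule n S) (c : Cl n) (ψ : S) :
    ρ.act c ψ = ρ.rep c ψ := rfl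

/-- `act` as a linear map. -/
def actₗ (ρ : SpinorModule n S) : Cl n →ₗ[ℝ] (S →L[ℝ] S) where
  toFun := ρ.act
  map_add' c d := by ext; simp
  map_smul' r c := by ext; simp

end SpinorModule

section Manifold

variable {n : ℕ} {M : Type*} [TopologicalSpace M] [ChartedSpace (EuclideanSpace ℝ (Fin n)) M]
  [IsManifold (𝓡 n) ∞ M] [RiemannianBundle (fun x : M => TangentSpace (𝓡 n) x)]

/-! ### Spin structures -/

variable (n M) in
/-- A spin structure on a Riemannian manifold, presented by local sections of the principal
`Spin(n)`-bundle: an open cover, on each member of the cover a smooth orthonormal frame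
(the image of the local section in the frame bundle), and on overlaps smooth transition functions
with values in `Spin(n)` which form a cocycle and lift the transition functions of the frames. -/
structure SpinStructure (ι : Type*) where
  /-- The members of the open cover. -/
  baseSet : ι → Set M
  isOpen_baseSet : ∀ a, IsOpen (baseSet a)
  /-- For each point the choice of a member of the cover containing it. -/
  indexAt : M → ι
  mem_baseSet_at : ∀ x, x ∈ baseSet (indexAt x)
  /-- The local orthonormal frames. -/
  frame : ι → Fin n → (x : M) → TangentSpace (𝓡 n) x
  contMDiffOn_frame : ∀ a i, ContMDiffOn (𝓡 n) (𝓡 n).tangent ∞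
    (fun x => (⟨x, frame a i x⟩ : TangentBundle (𝓡 n) M)) (baseSet a)
  orthonormal_frame : ∀ a, ∀ x ∈ baseSet a, Orthonormal ℝ (fun i => frame a i x)
  /-- The transition functions. -/
  trans : ι → ι → M → SpinGrp n
  /-- Smoothness of the transition functions, as maps into the finite dimensional vector space
  `Cl n`. -/
  contMDiffOn_trans : ∀ a b (l : Cl n →ₗ[ℝ] ℝ), ContMDiffOn (𝓡 n) 𝓘(ℝ, ℝ) ∞
    (fun x => l (trans a b x : Cl n)) (baseSet a ∩ baseSet b)
  trans_mul_trans : ∀ a b c, ∀ x ∈ baseSet a ∩ baseSet b ∩ baseSet c,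
    trans a b x * trans b c x = trans a c x
  /-- The image of `trans a b` in `SO(n)`, i.e. the map `v ↦ g v g⁻¹` on `ℝⁿ`, is the change from
  coordinates in frame `b` to coordinates in frame `a`. -/
  trans_frame : ∀ a b, ∀ x ∈ baseSet a ∩ baseSet b, ∀ i,
    (trans a b x : Cl n) * clBasis n i * ((trans a b x)⁻¹ : SpinGrp n) =
      ∑ j, (inner ℝ (frame a j x) (frame b i x) : ℝ) • clBasis n j

namespace SpinStructure

variable {ι : Type*} (P : SpinStructure n M ι)

/-- The orthonormal basis of the tangent space at `x` given by the chosen frame near `x`. -/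
def e (i : Fin n) (x : M) : TangentSpace (𝓡 n) x := P.frame (P.indexAt x) i x

theorem trans_self (a : ι) {x : M} (hx : x ∈ P.baseSet a) : P.trans a a x = 1 := by
  have h := P.trans_mul_trans a a a x ⟨⟨hx, hx⟩, hx⟩
  exact mul_eq_left.mp h

theorem inner_frame {a : ι} {x : M} (hx : x ∈ P.baseSet a) (i j : Fin n) :
    (inner ℝ (P.frame a i x) (P.frame a j x) : ℝ) = if i = j then 1 else 0 :=
  orthonormal_iff_ite.mp (P.orthonormal_frame a x hx) i j

theorem span_frame {a : ι} {x : M} (hx : x ∈ P.baseSet a) :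
    Submodule.span ℝ (Set.range fun i => P.frame a i x) = ⊤ := by
  have h : Module.finrank ℝ (TangentSpace (𝓡 n) x) = n := by
    change Module.finrank ℝ (EuclideanSpace ℝ (Fin n)) = n
    simp
  have : FiniteDimensional ℝ (TangentSpace (𝓡 n) x) :=
    inferInstanceAs (FiniteDimensional ℝ (EuclideanSpace ℝ (Fin n)))
  exact (P.orthonormal_frame a x hx).linearIndependent.span_eq_top_of_card_eq_finrank'
    (by rw [h, Fintype.card_fin])

theorem sum_inner_frame {a : ι} {x : M} (hx : x ∈ P.baseSet a) (v : TangentSpace (𝓡 n) x) :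
    ∑ k, (inner ℝ (P.frame a k x) v : ℝ) • P.frame a k x = v := by
  have h := (OrthonormalBasis.mk (P.orthonormal_frame a x hx) (P.span_frame hx).ge).sum_repr' v
  simpa using h

/-- The endomorphism `h^#`, with `⟨h^#(X), Y⟩ = h(Y, X)`. -/
def sharp (h : (x : M) → TangentSpace (𝓡 n) x →L[ℝ] TangentSpace (𝓡 n) x →L[ℝ] ℝ)
    (x : M) (X : TangentSpace (𝓡 n) x) : TangentSpace (𝓡 n) x :=
  ∑ j, h x (P.e j x) X • P.e j x

/-! ### The Levi-Civita connection -/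

/-- The structure functions `⟨[eᵢ, eⱼ], eₖ⟩` of the frame `a`. -/
def bracketCoeff (a : ι) (x : M) (i j k : Fin n) : ℝ :=
  inner ℝ (VectorField.mlieBracket (𝓡 n) (P.frame a i) (P.frame a j) x) (P.frame a k x)

/-- The Koszul formula for `⟨∇_{eᵢ} eⱼ, eₖ⟩` in the orthonormal frame `a`. -/
def christoffel (a : ι) (x : M) (i j k : Fin n) : ℝ :=
  (1 / 2) * (P.bracketCoeff a x i j k - P.bracketCoeff a x j k i + P.bracketCoeff a x k i j)

theorem bracketCoeff_swap (a : ι) (x : M) (i j k : Fin n) :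
    P.bracketCoeff a x i j k = -P.bracketCoeff a x j i k := by
  rw [bracketCoeff, VectorField.mlieBracket_swap_apply, inner_neg_left, bracketCoeff]

theorem christoffel_skew (a : ι) (x : M) (i j k : Fin n) :
    P.christoffel a x i j k = -P.christoffel a x i k j := by
  have h1 := P.bracketCoeff_swap a x i j k
  have h2 := P.bracketCoeff_swap a x j k i
  have h3 := P.bracketCoeff_swap a x k i j
  simp only [christoffel]
  linarith

theorem christoffel_sub (a : ι) (x : M) (i j k : Fin n) :
    P.christoffel a x i j k - P.christoffel a x j i k = P.bracketCoeff a x i j k := by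
  have h1 := P.bracketCoeff_swap a x i j k
  have h2 := P.bracketCoeff_swap a x j k i
  have h3 := P.bracketCoeff_swap a x k i j
  simp only [christoffel]
  linarith

/-- The components of `∇Y` at `x` in the frame `a`:
`(∇_v Y)ᵏ = v(Yᵏ) + ∑ᵢⱼ vⁱ Yʲ ⟨∇_{eᵢ} eⱼ, eₖ⟩`. -/
def nablaCoeff (a : ι) (Y : (x : M) → TangentSpace (𝓡 n) x) (x : M) (k : Fin n) :
    TangentSpace (𝓡 n) x →L[ℝ] ℝ :=
  mvfderiv (𝓡 n) (fun y => (inner ℝ (P.frame a k y) (Y y) : ℝ)) x +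
    ∑ i, ∑ j, ((inner ℝ (P.frame a j x) (Y x) : ℝ) * P.christoffel a x i j k) •
      innerSL ℝ (P.frame a i x)

theorem mdifferentiableAt_frame {a : ι} {x : M} (hx : x ∈ P.baseSet a) (i : Fin n) :
    MDifferentiableAt (𝓡 n) (𝓡 n).tangent
      (fun y => (⟨y, P.frame a i y⟩ : TangentBundle (𝓡 n) M)) x :=
  ((P.contMDiffOn_frame a i).contMDiffAt ((P.isOpen_baseSet a).mem_nhds hx)).mdifferentiableAt
    (by simp)

theorem mvfderiv_inner_frame {a : ι} {x : M} (hx : x ∈ P.baseSet a) (k j : Fin n) :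
    mvfderiv (𝓡 n) (fun y => (inner ℝ (P.frame a k y) (P.frame a j y) : ℝ)) x = 0 := by
  have : (fun y => (inner ℝ (P.frame a k y) (P.frame a j y) : ℝ))
      =ᶠ[𝓝 x] fun _ => if k = j then 1 else 0 := by
    filter_upwards [(P.isOpen_baseSet _).mem_nhds hx] with y hy using P.inner_frame hy k j
  ext v
  have h2 := congr($(this.mfderiv_eq (I := 𝓡 n) (I' := 𝓘(ℝ, ℝ))) v)
  simp only [mvfderiv, ContinuousLinearMap.comp_apply, h2, mfderiv_const, zero_apply]
  exact map_zero _

section LeviCivita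

variable [IsContMDiffRiemannianBundle (𝓡 n) ∞ (EuclideanSpace ℝ (Fin n))
  (fun x : M => TangentSpace (𝓡 n) x)]

instance instRiemannianOne : IsContMDiffRiemannianBundle (𝓡 n) 1 (EuclideanSpace ℝ (Fin n))
    (fun x : M => TangentSpace (𝓡 n) x) :=
  IsContMDiffRiemannianBundle.of_le (n := ∞) (by simp)

theorem mdifferentiableAt_coeff {a : ι} {x : M} (hx : x ∈ P.baseSet a) (k : Fin n)
    {Y : (x : M) → TangentSpace (𝓡 n) x}
    (hY : MDifferentiableAt (𝓡 n) (𝓡 n).tangent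
      (fun y => (⟨y, Y y⟩ : TangentBundle (𝓡 n) M)) x) :
    MDifferentiableAt (𝓡 n) 𝓘(ℝ, ℝ) (fun y => (inner ℝ (P.frame a k y) (Y y) : ℝ)) x :=
  MDifferentiableAt.inner_bundle (P.mdifferentiableAt_frame hx k) hY

/-- The Levi-Civita connection, given at each point through the Koszul formula in the
orthonormal frame chosen there. It is the torsion free metric connection, see
`leviCivita_isMetricCompatible` and `leviCivita_torsion`. -/
def leviCivita : CovariantDerivative (𝓡 n) (EuclideanSpace ℝ (Fin n))
    (fun x : M => TangentSpace (𝓡 n) x) where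
  toFun Y x := ∑ k, (P.nablaCoeff (P.indexAt x) Y x k).smulRight (P.e k x)
  isCovariantDerivativeOnUniv :=
    { add := by
        intro Y Y' x hY hY' _
        rw [← Finset.sum_add_distrib]
        refine Finset.sum_congr rfl fun k _ => ?_
        have h := mvfderiv_fun_add (P.mdifferentiableAt_coeff (P.mem_baseSet_at x) k hY)
          (P.mdifferentiableAt_coeff (P.mem_baseSet_at x) k hY')
        ext v
        simp only [nablaCoeff, Pi.add_apply, inner_add_right, h]
        simp [add_mul, add_smul, Finset.sum_add_distrib]
        module
      leibniz := by
        intro Y f x hY hf _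
        have h k := mvfderiv_fun_mul hf (P.mdifferentiableAt_coeff (P.mem_baseSet_at x) k hY)
        have hk k : P.nablaCoeff (P.indexAt x) (f • Y) x k = f x • P.nablaCoeff (P.indexAt x) Y x k +
            (inner ℝ (P.e k x) (Y x) : ℝ) • mvfderiv (𝓡 n) f x := by
          ext v
          simp only [nablaCoeff, Pi.smul_apply', inner_smul_right, h, mul_assoc, mul_smul,
            ← Finset.smul_sum, e, add_apply, smul_apply, smul_eq_mul]
          ring
        ext1 v
        have hv := P.sum_inner_frame (P.mem_baseSet_at x) (Y x)
        simp only [hk, sum_apply, ContinuousLinearMap.smulRight_apply,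
          add_apply, smul_apply, smul_eq_mul, add_smul,
          Finset.sum_add_distrib, Finset.smul_sum, mul_smul]
        congr 1
        conv_rhs => rw [← hv, Finset.smul_sum]
        refine Finset.sum_congr rfl fun k _ => ?_
        rw [smul_comm]
        rfl }

theorem leviCivita_frame {x : M} (i j : Fin n) :
    P.leviCivita (P.frame (P.indexAt x) j) x (P.e i x) =
      ∑ k, P.christoffel (P.indexAt x) x i j k • P.e k x := by
  have hx := P.mem_baseSet_at x
  simp only [leviCivita, sum_apply, ContinuousLinearMap.smulRight_apply,
    nablaCoeff, P.mvfderiv_inner_frame hx, zero_add, smul_apply, innerSL_apply_apply,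
    P.inner_frame hx, e]
  simp

set_option synthInstance.maxHeartbeats 200000 in
theorem leviCivita_isMetricCompatible : P.leviCivita.IsMetricCompatible := by
  have key (x : M) (i j k : Fin n) :
      P.leviCivita.derivMetricTensor x (P.e j x) (P.e k x) (P.e i x) = 0 := by
    have hx := P.mem_baseSet_at x
    have h := P.leviCivita.derivMetricTensor_apply (X := P.frame (P.indexAt x) i) x
      (P.mdifferentiableAt_frame hx j) (P.mdifferentiableAt_frame hx k)
    have hj := P.leviCivita_frame (x := x) i j
    have hk := P.leviCivita_frame (x := x) i k
    simp only [e] at hj hk ⊢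
    rw [h]
    simp only [hj, hk, P.mvfderiv_inner_frame hx, zero_apply, sum_inner, inner_sum,
      inner_smul_left, inner_smul_right, P.inner_frame hx]
    simp [P.christoffel_skew _ x i j k]
  unfold CovariantDerivative.IsMetricCompatible
  refine funext fun x => ContinuousLinearMap.ext fun u => ContinuousLinearMap.ext fun v =>
    ContinuousLinearMap.ext fun w => ?_
  rw [← P.sum_inner_frame (P.mem_baseSet_at x) u, ← P.sum_inner_frame (P.mem_baseSet_at x) v,
    ← P.sum_inner_frame (P.mem_baseSet_at x) w]
  simp only [map_sum, map_smul, sum_apply, smul_apply]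
  simp only [e] at key
  simp [key]

theorem leviCivita_torsion : P.leviCivita.torsion = 0 := by
  have key (x : M) (i j : Fin n) : P.leviCivita.torsion x (P.e i x) (P.e j x) = 0 := by
    have hx := P.mem_baseSet_at x
    have h := P.leviCivita.torsion_apply
      (P.mdifferentiableAt_frame hx i) (P.mdifferentiableAt_frame hx j)
    have hi := P.leviCivita_frame (x := x) i j
    have hj := P.leviCivita_frame (x := x) j i
    simp only [e] at hi hj ⊢
    rw [h, hi, hj, ← Finset.sum_sub_distrib, sub_eq_zero]
    simp only [← sub_smul, P.christoffel_sub]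
    rw [← P.sum_inner_frame hx (VectorField.mlieBracket (𝓡 n) _ _ x)]
    refine Finset.sum_congr rfl fun k _ => ?_
    rw [bracketCoeff, real_inner_comm]
  ext1 x
  ext u v
  rw [← P.sum_inner_frame (P.mem_baseSet_at x) u, ← P.sum_inner_frame (P.mem_baseSet_at x) v]
  simp only [map_sum, map_smul, sum_apply, smul_apply]
  simp only [e] at key
  simp [key]

end LeviCivita

/-! ### The spinor bundle -/

section Spinor

variable {S : Type*} [NormedAddCommGroup S] [NormedSpace ℂ S] [FiniteDimensional ℂ S]
  (ρ : SpinorModule n S)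

theorem contMDiffOn_act_trans (a b : ι) : ContMDiffOn (𝓡 n) 𝓘(ℝ, S →L[ℝ] S) ∞
    (fun x => ρ.act (P.trans a b x : Cl n)) (P.baseSet a ∩ P.baseSet b) := by
  let B := Module.finBasis ℝ (S →L[ℝ] S)
  have h (x : M) : ρ.act (P.trans a b x : Cl n) =
      ∑ k, ((B.coord k).comp ρ.actₗ) (P.trans a b x : Cl n) • B k :=
    (B.sum_repr _).symm
  simp only [h]
  exact contMDiffOn_finsetSum fun k _ => (P.contMDiffOn_trans a b _).smul contMDiffOn_const

/-- The associated bundle `P ×_{Spin(n)} S`: in the member `a` of the cover a spinor is given by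
an element of `S`, and on overlaps `ψ_a = ρ(trans a b) ψ_b`. -/
def spinorCore : VectorBundleCore ℝ M S ι where
  baseSet := P.baseSet
  isOpen_baseSet := P.isOpen_baseSet
  indexAt := P.indexAt
  mem_baseSet_at := P.mem_baseSet_at
  coordChange b a x := ρ.act (P.trans a b x : Cl n)
  coordChange_self a x hx v := by simp [P.trans_self a hx]
  continuousOn_coordChange b a := by
    rw [Set.inter_comm]
    exact (P.contMDiffOn_act_trans ρ a b).continuousOn
  coordChange_comp c b a x hx v := by
    rw [← P.trans_mul_trans a b c x ⟨⟨hx.2, hx.1.2⟩, hx.1.1⟩]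
    simp

/-- The spinor bundle. -/
abbrev Spinor (x : M) : Type _ := (P.spinorCore ρ).Fiber x

instance : (P.spinorCore ρ).IsContMDiff (𝓡 n) ∞ where
  contMDiffOn_coordChange b a := by
    have h := P.contMDiffOn_act_trans ρ a b
    rwa [Set.inter_comm] at h

instance (x : M) : IsTopologicalAddGroup (P.Spinor ρ x) := inferInstanceAs (IsTopologicalAddGroup S)

instance (x : M) : ContinuousSMul ℝ (P.Spinor ρ x) := inferInstanceAs (ContinuousSMul ℝ S)

/-- The action of a Clifford algebra element on the spinors at `x`, in the gauge chosen at `x`. -/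
def actAt (x : M) (c : Cl n) : P.Spinor ρ x →L[ℝ] P.Spinor ρ x := ρ.act c

/-- Clifford multiplication `X · ψ` of a spinor by a tangent vector `X = ∑ⱼ ⟨eⱼ, X⟩ eⱼ`. -/
def clifford (x : M) : TangentSpace (𝓡 n) x →ₗ[ℝ] P.Spinor ρ x →L[ℝ] P.Spinor ρ x where
  toFun X := ∑ j, (inner ℝ (P.e j x) X : ℝ) • P.actAt ρ x (clBasis n j)
  map_add' X Y := by simp [inner_add_right, add_smul, Finset.sum_add_distrib]
  map_smul' r X := by simp [inner_smul_right, mul_smul, Finset.smul_sum]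

variable [IsContMDiffRiemannianBundle (𝓡 n) ∞ (EuclideanSpace ℝ (Fin n))
  (fun x : M => TangentSpace (𝓡 n) x)]

/-- The connection form `v ↦ ¼ ∑ⱼₖ ⟨∇_v eⱼ, eₖ⟩ eⱼ · eₖ` of the spinor connection at `x`, in the
gauge chosen at `x`. -/
def spinForm (x : M) (ψ : S) : TangentSpace (𝓡 n) x →L[ℝ] S :=
  (1 / 4 : ℝ) • ∑ j, ∑ k,
    ((innerSL ℝ (P.e k x)).comp (P.leviCivita (P.frame (P.indexAt x) j) x)).smulRight
      (ρ.act (clBasis n j * clBasis n k) ψ)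

theorem spinForm_add (x : M) (a b : S) :
    P.spinForm ρ x (a + b) = P.spinForm ρ x a + P.spinForm ρ x b := by
  refine ContinuousLinearMap.ext fun v => ?_
  simp only [spinForm, map_add, add_apply, smul_apply, sum_apply,
    ContinuousLinearMap.smulRight_apply, smul_add, Finset.sum_add_distrib]

theorem spinForm_smul (x : M) (r : ℝ) (a : S) :
    P.spinForm ρ x (r • a) = r • P.spinForm ρ x a := by
  refine ContinuousLinearMap.ext fun v => ?_
  simp only [spinForm, map_smul, smul_apply, sum_apply,
    ContinuousLinearMap.smulRight_apply, Finset.smul_sum]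
  refine Finset.sum_congr rfl fun j _ => Finset.sum_congr rfl fun k _ => ?_
  module

/-- The spinor connection induced by the Levi-Civita connection: in the local gauge given by an
orthonormal frame, `∇_v ψ = v(ψ) + ¼ ∑ⱼₖ ⟨∇_v eⱼ, eₖ⟩ eⱼ · eₖ · ψ`. -/
def spinConnection : CovariantDerivative (𝓡 n) S (P.Spinor ρ) where
  toFun ψ x := (mvfderiv (𝓡 n) (fun y => (trivializationAt S (P.Spinor ρ) x ⟨y, ψ y⟩).2) x +
    P.spinForm ρ x (ψ x) : TangentSpace (𝓡 n) x →L[ℝ] S)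
  isCovariantDerivativeOnUniv :=
    { add := by
        intro ψ ψ' x h h' _
        have h1 := (mdifferentiableAt_section (𝓡 n) ψ).mp h
        have h2 := (mdifferentiableAt_section (𝓡 n) ψ').mp h'
        have hL y (a b : P.Spinor ρ y) : (trivializationAt S (P.Spinor ρ) x ⟨y, a + b⟩).2 =
            (trivializationAt S (P.Spinor ρ) x ⟨y, a⟩).2 +
              (trivializationAt S (P.Spinor ρ) x ⟨y, b⟩).2 :=
          map_add ((P.spinorCore ρ).coordChange (P.indexAt y) (P.indexAt x) y) a b
        have h3 := mvfderiv_fun_add h1 h2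
        simp only [Pi.add_apply, hL, h3]
        erw [P.spinForm_add ρ x (ψ x) (ψ' x)]
        exact add_add_add_comm _ _ _ _
      leibniz := by
        intro ψ f x h hf _
        have h1 := (mdifferentiableAt_section (𝓡 n) ψ).mp h
        have hL y (a : P.Spinor ρ y) : (trivializationAt S (P.Spinor ρ) x ⟨y, f y • a⟩).2 =
            f y • (trivializationAt S (P.Spinor ρ) x ⟨y, a⟩).2 :=
          map_smul ((P.spinorCore ρ).coordChange (P.indexAt y) (P.indexAt x) y) (f y) a
        have h3 := mvfderiv_fun_smul hf h1
        have h4 : (trivializationAt S (P.Spinor ρ) x ⟨x, ψ x⟩).2 = ψ x :=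
          congrArg Prod.snd ((P.spinorCore ρ).localTrivAt_apply_mk x (ψ x))
        simp only [Pi.smul_apply', hL, h3, h4]
        erw [P.spinForm_smul ρ x (f x) (ψ x), smul_add]
        exact add_right_comm _ _ _ }

/-! ### Differential operators -/

/-- The Dirac operator `D ψ = ∑ᵢ eᵢ · ∇_{eᵢ} ψ`. -/
def dirac (ψ : (x : M) → P.Spinor ρ x) (x : M) : P.Spinor ρ x :=
  ∑ i, P.clifford ρ x (P.e i x) (P.spinConnection ρ ψ x (P.e i x))

/-- The product connection on `Σ ⊗ T*M = Hom(TM, Σ)`: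
`(∇_v A)(X) = ∇_v (A(X)) - A(∇_v X)`, where `X` is extended to a vector field near `x`. -/
def twistedConnection (A : (x : M) → TangentSpace (𝓡 n) x →L[ℝ] P.Spinor ρ x) (x : M)
    (v X : TangentSpace (𝓡 n) x) : P.Spinor ρ x :=
  P.spinConnection ρ (fun y => A y (extend (EuclideanSpace ℝ (Fin n)) X y)) x v -
    A x (P.leviCivita (extend (EuclideanSpace ℝ (Fin n)) X) x v)

/-- The twisted Dirac operator `D^{T*M} A = ∑ᵢ eᵢ · ∇_{eᵢ} A` on sections of `Σ ⊗ T*M`,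
evaluated at the tangent vector `X`. -/
def twistedDirac (A : (x : M) → TangentSpace (𝓡 n) x →L[ℝ] P.Spinor ρ x) (x : M)
    (X : TangentSpace (𝓡 n) x) : P.Spinor ρ x :=
  ∑ i, P.clifford ρ x (P.e i x) (P.twistedConnection ρ A x (P.e i x) X)

end Spinor

section Tensor

variable [IsContMDiffRiemannianBundle (𝓡 n) ∞ (EuclideanSpace ℝ (Fin n))
  (fun x : M => TangentSpace (𝓡 n) x)]
  (h : (x : M) → TangentSpace (𝓡 n) x →L[ℝ] TangentSpace (𝓡 n) x →L[ℝ] ℝ)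

/-- The covariant derivative of a bilinear form,
`(∇_v h)(X, Y) = v(h(X, Y)) - h(∇_v X, Y) - h(X, ∇_v Y)`, where `X` and `Y` are extended to vector
fields near `x`. -/
def nablaBilin (x : M) (v X Y : TangentSpace (𝓡 n) x) : ℝ :=
  mvfderiv (𝓡 n) (fun y => h y (extend (EuclideanSpace ℝ (Fin n)) X y)
      (extend (EuclideanSpace ℝ (Fin n)) Y y)) x v -
    h x (P.leviCivita (extend (EuclideanSpace ℝ (Fin n)) X) x v) Y -
    h x X (P.leviCivita (extend (EuclideanSpace ℝ (Fin n)) Y) x v)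

/-- The divergence `(div h)(X) = -∑ᵢ (∇_{eᵢ} h)(X, eᵢ)`. -/
def div (x : M) (X : TangentSpace (𝓡 n) x) : ℝ :=
  -∑ i, P.nablaBilin h x (P.e i x) X (P.e i x)

variable {S : Type*} [NormedAddCommGroup S] [NormedSpace ℂ S] [FiniteDimensional ℂ S]
  (ρ : SpinorModule n S) (φ : (x : M) → P.Spinor ρ x)

/-- The Wang map `W_{g,φ}(h) = (X ↦ ∑ⱼ h(X, eⱼ) eⱼ · φ)`. -/
def wang (x : M) : TangentSpace (𝓡 n) x →L[ℝ] P.Spinor ρ x :=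
  ∑ j, ((h x).flip (P.e j x)).smulRight (P.clifford ρ x (P.e j x) (φ x))

/-- `κ_{g,φ}(h)(X) = ¼ ∑_{i ≠ j} (∇_{eᵢ} h)(X, eⱼ) eᵢ · eⱼ · φ`. -/
def kappa (x : M) (X : TangentSpace (𝓡 n) x) : P.Spinor ρ x :=
  (1 / 4 : ℝ) • ∑ i, ∑ j, if i ≠ j then
    P.nablaBilin h x (P.e i x) X (P.e j x) •
      P.clifford ρ x (P.e i x) (P.clifford ρ x (P.e j x) (φ x)) else 0

end Tensor

end SpinStructure
end Manifold
end SpinGeometry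

end

namespace SpinGeometry

/-! Since `h` is symmetric, the Wang map is Clifford multiplication by the endomorphism: `W(h)(X) =
h^#(X) · φ` (`wang_apply`). The formula then follows from the Leibniz rule `∇_v (Z · ψ) = ∇_v Z · ψ
+ Z · ∇_v ψ` (`spinConnection_clifford`). With `Z = h^#(X)` it gives `(∇_v W)(X) = (∇_v h^#)(X) · φ
+ h^#(X) · ∇_v φ`, and metric compatibility identifies `(∇_v h^#)(X)` with the dual of `(∇_v h)(X,
·)` (`nablaBilin_eq_inner`).

Put `v = eᵢ`, multiply by `eᵢ` and sum. In the first term the off-diagonal part of the double sum is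
`4κ`, and the diagonal part is `div h · φ` because `eᵢ · eᵢ = -1`. In the second term, moving `eᵢ`
past `h^#(X)` costs `-2⟨eᵢ, h^#(X)⟩` and a sign, which produces `-2∇_{h^#(X)} φ` and `-h^#(X) · Dφ`.
Both of these vanish for parallel `φ`.

The Leibniz rule is checked in a fixed gauge. There the connection form is `ω = ¼ ∑ ⟨∇_v eⱼ, eₖ⟩ eⱼ
eₖ`, and the Clifford relations together with skewness of its coefficients give `[ω, e_m] = ∇_v e_m`
(`act_clBasis_commutator`). This is what the derivative of the components of `Z` leaves to be
compensated. -/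

theorem mvfderiv_fun_sum {E H M F : Type*} {ι : Type} [NormedAddCommGroup E] [NormedSpace ℝ E]
    [TopologicalSpace H] {I : ModelWithCorners ℝ E H} [TopologicalSpace M] [ChartedSpace H M]
    [NormedAddCommGroup F] [NormedSpace ℝ F] {f : ι → M → F} {x : M} (s : Finset ι)
    (hf : ∀ i ∈ s, MDifferentiableAt I 𝓘(ℝ, F) (f i) x) :
    mvfderiv I (fun y => ∑ i ∈ s, f i y) x = ∑ i ∈ s, mvfderiv I (f i) x := by
  classical
  induction s using Finset.induction_on with
  | empty => simpa using mvfderiv_const (I := I) (0 : F)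
  | insert i s hi ih =>
    have hs : MDifferentiableAt I 𝓘(ℝ, F) (fun y => ∑ j ∈ s, f j y) x := by
      rw [← Finset.sum_fn]
      exact MDifferentiableAt.sum fun j hj => hf j (Finset.mem_insert_of_mem hj)
    simp only [Finset.sum_insert hi]
    rw [mvfderiv_fun_add (hf i (Finset.mem_insert_self i s)) hs, ih fun j hj => hf j (Finset.mem_insert_of_mem hj)]

/-! ### Clifford relations and the commutator of a vector with a spin element. -/

theorem clBasis_mul_add_swap (n : ℕ) (i j : Fin n) :
    clBasis n i * clBasis n j + clBasis n j * clBasis n i =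
      algebraMap ℝ (Cl n) (if i = j then -2 else 0) := by
  rw [clBasis, clBasis, CliffordAlgebra.ι_mul_ι_add_swap]
  congr 1
  simp only [QuadraticMap.polar, QuadraticMap.weightedSumSquares_apply, Pi.add_apply, smul_eq_mul,
    ← Finset.sum_sub_distrib]
  have h (k : Fin n) : (-1 * ((Pi.single i 1 + Pi.single j 1 : Fin n → ℝ) k *
      (Pi.single i 1 + Pi.single j 1 : Fin n → ℝ) k) -
      -1 * ((Pi.single i 1 : Fin n → ℝ) k * (Pi.single i 1 : Fin n → ℝ) k)) -
      -1 * ((Pi.single j 1 : Fin n → ℝ) k * (Pi.single j 1 : Fin n → ℝ) k) =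
      (-2 * (Pi.single i 1 : Fin n → ℝ) k) * (Pi.single j 1 : Fin n → ℝ) k := by
    simp only [Pi.add_apply]; ring
  simp only [Pi.add_apply] at h
  simp only [h]
  simp [Pi.single_apply, eq_comm]

namespace SpinorModule

variable {n : ℕ} {S : Type*} [NormedAddCommGroup S] [NormedSpace ℂ S] [FiniteDimensional ℂ S]
  (ρ : SpinorModule n S)

theorem act_clBasis_anticomm (i j : Fin n) (ψ : S) :
    ρ.act (clBasis n i) (ρ.act (clBasis n j) ψ) + ρ.act (clBasis n j) (ρ.act (clBasis n i) ψ) =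
      (if i = j then -2 else 0 : ℝ) • ψ := by
  have h := congrArg (fun c => ρ.rep c ψ) (clBasis_mul_add_swap n i j)
  simpa only [map_add, map_mul, AlgHom.commutes, Module.End.mul_apply, LinearMap.add_apply,
    Module.algebraMap_end_apply, act_apply] using h

/-- The commutator of a vector with the spin element `¼ ∑ⱼₖ Aⱼₖ Eⱼ Eₖ` of a skew matrix `A`. -/
theorem act_clBasis_commutator (A : Fin n → Fin n → ℝ) (hA : ∀ j k, A j k = -A k j) (m : Fin n)
    (ψ : S) :
    ρ.act (clBasis n m)
        ((1 / 4 : ℝ) • ∑ j, ∑ k, A j k • ρ.act (clBasis n j * clBasis n k) ψ) =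
      (1 / 4 : ℝ) • ∑ j, ∑ k, A j k • ρ.act (clBasis n j * clBasis n k) (ρ.act (clBasis n m) ψ) +
        ∑ k, A k m • ρ.act (clBasis n k) ψ := by
  have hmul (c d : Cl n) (χ : S) : ρ.act (c * d) χ = ρ.act c (ρ.act d χ) := by simp
  -- Two anticommutations carry `E_m` to the right through `E_j E_k`; each leaves a Kronecker delta
  -- term.
  have key (j k : Fin n) : ρ.act (clBasis n m) (ρ.act (clBasis n j) (ρ.act (clBasis n k) ψ)) =
      ρ.act (clBasis n j) (ρ.act (clBasis n k) (ρ.act (clBasis n m) ψ)) +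
        ((if m = j then -2 else 0 : ℝ) • ρ.act (clBasis n k) ψ -
          (if m = k then -2 else 0 : ℝ) • ρ.act (clBasis n j) ψ) := by
    have h1 := ρ.act_clBasis_anticomm m j (ρ.act (clBasis n k) ψ)
    have h2 := congrArg (ρ.act (clBasis n j)) (ρ.act_clBasis_anticomm m k ψ)
    rw [map_add, map_smul] at h2
    rw [← h1, ← h2]
    abel
  -- Skewness of `A` turns the two delta terms into `2` and `-2` times the same vector. Their
  -- difference has coefficient `4`, which the factor `¼` cancels.
  have e1 : ∑ j, ∑ k, A j k • ((if m = j then -2 else 0 : ℝ) • ρ.act (clBasis n k) ψ) =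
      (2 : ℝ) • ∑ k, A k m • ρ.act (clBasis n k) ψ := by
    rw [Finset.sum_comm, Finset.smul_sum]
    refine Finset.sum_congr rfl fun k _ => ?_
    simp only [ite_smul, zero_smul, smul_ite, smul_zero, Finset.sum_ite_eq, Finset.mem_univ,
      if_true, hA m k]
    module
  have e2 : ∑ j, ∑ k, A j k • ((if m = k then -2 else 0 : ℝ) • ρ.act (clBasis n j) ψ) =
      (-2 : ℝ) • ∑ k, A k m • ρ.act (clBasis n k) ψ := by
    rw [Finset.smul_sum]
    refine Finset.sum_congr rfl fun k _ => ?_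
    simp only [ite_smul, zero_smul, smul_ite, smul_zero, Finset.sum_ite_eq, Finset.mem_univ,
      if_true]
    module
  simp only [map_smul, map_sum, hmul, key, smul_add, smul_sub, Finset.sum_add_distrib,
    Finset.sum_sub_distrib, e1, e2]
  module

theorem act_vector_commutator (A : Fin n → Fin n → ℝ) (hA : ∀ j k, A j k = -A k j)
    (z : Fin n → ℝ) (ψ : S) :
    ∑ m, z m • ρ.act (clBasis n m)
        ((1 / 4 : ℝ) • ∑ j, ∑ k, A j k • ρ.act (clBasis n j * clBasis n k) ψ) =
      (1 / 4 : ℝ) • ∑ j, ∑ k, A j k • ρ.act (clBasis n j * clBasis n k)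
          (∑ m, z m • ρ.act (clBasis n m) ψ) +
        ∑ k, (∑ m, z m * A k m) • ρ.act (clBasis n k) ψ := by
  -- Treating the spin element as one linear operator keeps its double sum closed while it passes
  -- through the sum over `m`.
  let T : S →L[ℝ] S := (1 / 4 : ℝ) • ∑ j, ∑ k, A j k • ρ.act (clBasis n j * clBasis n k)
  have hT (χ : S) :
      (1 / 4 : ℝ) • ∑ j, ∑ k, A j k • ρ.act (clBasis n j * clBasis n k) χ = T χ := by
    simp [T]
  have hc (m : Fin n) := ρ.act_clBasis_commutator A hA m ψ
  simp only [hT] at hc ⊢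
  simp only [hc, smul_add, Finset.sum_add_distrib, map_sum, map_smul, Finset.sum_smul,
    Finset.smul_sum, mul_smul]
  rw [Finset.sum_comm (f := fun m k => z m • A k m • ρ.act (clBasis n k) ψ)]

end SpinorModule

/-! ### The endomorphism `h^#` and its covariant derivative. -/

namespace SpinStructure

variable {n : ℕ} {M : Type*} [TopologicalSpace M] [ChartedSpace (EuclideanSpace ℝ (Fin n)) M]
  [IsManifold (𝓡 n) ∞ M] [RiemannianBundle (fun x : M => TangentSpace (𝓡 n) x)]
  {ι : Type*} (P : SpinStructure n M ι)

theorem sum_inner_mul_inner_frame {a : ι} {x : M} (hx : x ∈ P.baseSet a)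
    (v w : TangentSpace (𝓡 n) x) :
    ∑ k, (inner ℝ (P.frame a k x) v : ℝ) * inner ℝ w (P.frame a k x) = inner ℝ w v := by
  conv_rhs => rw [← P.sum_inner_frame hx v]
  simp [inner_sum, inner_smul_right]

theorem inner_sum_frame {a : ι} {x : M} (hx : x ∈ P.baseSet a)
    (α : TangentSpace (𝓡 n) x →L[ℝ] ℝ) (Y : TangentSpace (𝓡 n) x) :
    (inner ℝ Y (∑ j, α (P.frame a j x) • P.frame a j x) : ℝ) = α Y := by
  conv_rhs => rw [← P.sum_inner_frame hx Y]
  simp only [inner_sum, inner_smul_right, map_sum, map_smul, smul_eq_mul]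
  refine Finset.sum_congr rfl fun j _ => ?_
  rw [real_inner_comm, mul_comm]

section Tensor

variable (h : (x : M) → TangentSpace (𝓡 n) x →L[ℝ] TangentSpace (𝓡 n) x →L[ℝ] ℝ)

theorem inner_sharp (x : M) (X Y : TangentSpace (𝓡 n) x) :
    (inner ℝ Y (P.sharp h x X) : ℝ) = h x Y X :=
  P.inner_sum_frame (P.mem_baseSet_at x) ((h x).flip X) Y

/-- The pairing with all `Y` determines `h^#(X)`, so the frame does not matter. This is needed
because the frame in the definition of `sharp` is chosen separately at each point and may jump. -/
theorem sharp_eq_sum_frame {a : ι} {x : M} (hx : x ∈ P.baseSet a) (X : TangentSpace (𝓡 n) x) :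
    P.sharp h x X = ∑ j, h x (P.frame a j x) X • P.frame a j x :=
  ext_inner_left ℝ fun Y =>
    (P.inner_sharp h x X Y).trans (P.inner_sum_frame hx ((h x).flip X) Y).symm

theorem mdifferentiableAt_sharp
    (hh : ContMDiff (𝓡 n) ((𝓡 n).prod 𝓘(ℝ, EuclideanSpace ℝ (Fin n) →L[ℝ]
        EuclideanSpace ℝ (Fin n) →L[ℝ] ℝ)) ∞
      (fun x => TotalSpace.mk' (EuclideanSpace ℝ (Fin n) →L[ℝ]
        EuclideanSpace ℝ (Fin n) →L[ℝ] ℝ) x (h x)))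
    {x : M} {Y : (x : M) → TangentSpace (𝓡 n) x}
    (hY : MDifferentiableAt (𝓡 n) (𝓡 n).tangent
      (fun y => (⟨y, Y y⟩ : TangentBundle (𝓡 n) M)) x) :
    MDifferentiableAt (𝓡 n) (𝓡 n).tangent
      (fun y => (⟨y, P.sharp h y (Y y)⟩ : TangentBundle (𝓡 n) M)) x := by
  have hx := P.mem_baseSet_at x
  have hb (j : Fin n) : MDifferentiableAt (𝓡 n) 𝓘(ℝ, ℝ)
      (fun y => h y (P.frame (P.indexAt x) j y) (Y y)) x := by
    have := MDifferentiableAt.clm_bundle_apply₂ (E₃ := Bundle.Trivial M ℝ) (F₃ := ℝ)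
      ((hh x).mdifferentiableAt (by simp)) (P.mdifferentiableAt_frame hx j) hY
    rw [mdifferentiableAt_section] at this
    exact this
  have hs : MDifferentiableAt (𝓡 n) (𝓡 n).tangent (fun y => (⟨y, ∑ j,
      h y (P.frame (P.indexAt x) j y) (Y y) • P.frame (P.indexAt x) j y⟩ :
        TangentBundle (𝓡 n) M)) x :=
    MDifferentiableAt.sum_section fun j _ =>
      (hb j).smul_section (P.mdifferentiableAt_frame hx j)
  refine hs.congr_of_eventuallyEq ?_
  filter_upwards [(P.isOpen_baseSet _).mem_nhds hx] with y hy
  rw [P.sharp_eq_sum_frame h hy]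

variable [IsContMDiffRiemannianBundle (𝓡 n) ∞ (EuclideanSpace ℝ (Fin n))
  (fun x : M => TangentSpace (𝓡 n) x)]

/-- The covariant derivative of `h` in terms of the endomorphism `h^#`. -/
theorem nablaBilin_eq_inner
    (hh : ContMDiff (𝓡 n) ((𝓡 n).prod 𝓘(ℝ, EuclideanSpace ℝ (Fin n) →L[ℝ]
        EuclideanSpace ℝ (Fin n) →L[ℝ] ℝ)) ∞
      (fun x => TotalSpace.mk' (EuclideanSpace ℝ (Fin n) →L[ℝ]
        EuclideanSpace ℝ (Fin n) →L[ℝ] ℝ) x (h x)))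
    (h_symm : ∀ x u v, h x u v = h x v u) (x : M) (v X Y : TangentSpace (𝓡 n) x) :
    P.nablaBilin h x v X Y = inner ℝ Y
      (P.leviCivita (fun y => P.sharp h y (extend (EuclideanSpace ℝ (Fin n)) X y)) x v -
        P.sharp h x (P.leviCivita (extend (EuclideanSpace ℝ (Fin n)) X) x v)) := by
  have hX := P.mdifferentiableAt_sharp h hh
    (mdifferentiableAt_extend (𝓡 n) (EuclideanSpace ℝ (Fin n)) X)
  have hY := mdifferentiableAt_extend (𝓡 n) (EuclideanSpace ℝ (Fin n)) Y
  -- Differentiate `⟨Y, h^#(X)⟩ = h(X, Y)` along the extended fields; the term with `∇_v Y` is the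
  -- one subtracted in `nablaBilin`.
  have hm := P.leviCivita_isMetricCompatible.mvfderiv_inner_eq
    (extend (EuclideanSpace ℝ (Fin n)) v) hY hX
  have hZ : (fun y => h y (extend (EuclideanSpace ℝ (Fin n)) X y)
      (extend (EuclideanSpace ℝ (Fin n)) Y y)) =
      fun y => (inner ℝ (extend (EuclideanSpace ℝ (Fin n)) Y y)
        (P.sharp h y (extend (EuclideanSpace ℝ (Fin n)) X y)) : ℝ) := by
    ext y
    rw [inner_sharp, h_symm]
  simp only [extend_apply_self, inner_sharp] at hm
  rw [nablaBilin, inner_sub_right, inner_sharp, hZ]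
  simp only [inner_sharp]
  rw [hm, h_symm x _ Y, h_symm x X]
  ring

end Tensor

end SpinStructure

/-! ### Clifford multiplication on the spinor bundle and its gauge invariance. -/

namespace SpinStructure

variable {n : ℕ} {M : Type*} [TopologicalSpace M] [ChartedSpace (EuclideanSpace ℝ (Fin n)) M]
  [IsManifold (𝓡 n) ∞ M] [RiemannianBundle (fun x : M => TangentSpace (𝓡 n) x)]
  {ι : Type*} (P : SpinStructure n M ι)
  {S : Type*} [NormedAddCommGroup S] [NormedSpace ℂ S] [FiniteDimensional ℂ S]
  (ρ : SpinorModule n S)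

theorem clifford_apply (x : M) (X : TangentSpace (𝓡 n) x) (ψ : P.Spinor ρ x) :
    P.clifford ρ x X ψ =
      ∑ j, (inner ℝ (P.frame (P.indexAt x) j x) X : ℝ) • P.actAt ρ x (clBasis n j) ψ := by
  simp [clifford, e]

theorem clifford_e (x : M) (i : Fin n) (ψ : P.Spinor ρ x) :
    P.clifford ρ x (P.e i x) ψ = P.actAt ρ x (clBasis n i) ψ := by
  simp [clifford_apply, e, P.inner_frame (P.mem_baseSet_at x)]

theorem clifford_anticomm (x : M) (X Y : TangentSpace (𝓡 n) x) (ψ : P.Spinor ρ x) :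
    P.clifford ρ x X (P.clifford ρ x Y ψ) + P.clifford ρ x Y (P.clifford ρ x X ψ) =
      (-2 * inner ℝ X Y : ℝ) • ψ := by
  have hE (i j : Fin n) : P.actAt ρ x (clBasis n i) (P.actAt ρ x (clBasis n j) ψ) +
      P.actAt ρ x (clBasis n j) (P.actAt ρ x (clBasis n i) ψ) =
      (if i = j then -2 else 0 : ℝ) • ψ := ρ.act_clBasis_anticomm i j ψ
  have e1 : P.clifford ρ x X (P.clifford ρ x Y ψ) =
      ∑ i, ∑ j, ((inner ℝ (P.frame (P.indexAt x) i x) X : ℝ) *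
        inner ℝ (P.frame (P.indexAt x) j x) Y) •
        P.actAt ρ x (clBasis n i) (P.actAt ρ x (clBasis n j) ψ) := by
    simp only [clifford_apply, map_sum, map_smul, Finset.smul_sum, smul_smul]
    rw [Finset.sum_comm]
    exact Finset.sum_congr rfl fun i _ => Finset.sum_congr rfl fun j _ => by rw [mul_comm]
  have e2 : P.clifford ρ x Y (P.clifford ρ x X ψ) =
      ∑ i, ∑ j, ((inner ℝ (P.frame (P.indexAt x) i x) X : ℝ) *
        inner ℝ (P.frame (P.indexAt x) j x) Y) •
        P.actAt ρ x (clBasis n j) (P.actAt ρ x (clBasis n i) ψ) := by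
    simp only [clifford_apply, map_sum, map_smul, Finset.smul_sum, smul_smul]
  rw [e1, e2, ← Finset.sum_add_distrib]
  simp only [← Finset.sum_add_distrib, ← smul_add, hE]
  rw [← P.sum_inner_mul_inner_frame (P.mem_baseSet_at x), Finset.mul_sum, Finset.sum_smul]
  refine Finset.sum_congr rfl fun i _ => ?_
  simp only [ite_smul, zero_smul, smul_ite, smul_zero, Finset.sum_ite_eq, Finset.mem_univ,
    if_true, smul_smul]
  rw [real_inner_comm X]
  congr 1
  ring

/-- A spinor at `y` in the gauge chosen at `x`. -/
noncomputable def gauge (x y : M) (ψ : P.Spinor ρ y) : S :=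
  (trivializationAt S (P.Spinor ρ) x ⟨y, ψ⟩).2

theorem gauge_eq (x y : M) (ψ : P.Spinor ρ y) :
    P.gauge ρ x y ψ = ρ.act (P.trans (P.indexAt x) (P.indexAt y) y : Cl n) ψ := rfl

theorem gauge_self (x : M) (ψ : P.Spinor ρ x) : P.gauge ρ x x ψ = ψ := by
  rw [gauge_eq, P.trans_self _ (P.mem_baseSet_at x)]
  have h (s : S) : ρ.act ((1 : SpinGrp n) : Cl n) s = s := by simp
  exact h ψ

/-- Clifford multiplication in a fixed gauge. -/
theorem gauge_clifford {x y : M} (hy : y ∈ P.baseSet (P.indexAt x)) (Z : TangentSpace (𝓡 n) y)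
    (ψ : P.Spinor ρ y) :
    P.gauge ρ x y (P.clifford ρ y Z ψ) = ∑ j, (inner ℝ (P.frame (P.indexAt x) j y) Z : ℝ) •
      ρ.act (clBasis n j) (P.gauge ρ x y ψ) := by
  have hyy := P.mem_baseSet_at y
  set g := P.trans (P.indexAt x) (P.indexAt y) y with hg
  have hmul (c d : Cl n) (χ : S) : ρ.act (c * d) χ = ρ.act c (ρ.act d χ) := by simp
  -- The lifting condition `g Eᵢ g⁻¹ = ∑ⱼ ⟨·,·⟩ Eⱼ`, multiplied by `g` on the right.
  have hE (i : Fin n) : (g : Cl n) * clBasis n i =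
      ∑ j, (inner ℝ (P.frame (P.indexAt x) j y) (P.frame (P.indexAt y) i y) : ℝ) •
        (clBasis n j * (g : Cl n)) := by
    have h := congrArg (· * (g : Cl n)) (P.trans_frame (P.indexAt x) (P.indexAt y) y ⟨hy, hyy⟩ i)
    have hinv : ((g⁻¹ : SpinGrp n) : Cl n) * (g : Cl n) = 1 := by
      rw [← Submonoid.coe_mul, inv_mul_cancel, Submonoid.coe_one]
    simp only [← hg] at h
    rw [mul_assoc, hinv, mul_one, Finset.sum_mul] at h
    simpa only [smul_mul_assoc] using h
  have hA (i : Fin n) (χ : S) : ρ.act g (ρ.act (clBasis n i) χ) =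
      ∑ j, (inner ℝ (P.frame (P.indexAt x) j y) (P.frame (P.indexAt y) i y) : ℝ) •
        ρ.act (clBasis n j) (ρ.act g χ) := by
    rw [← hmul, hE]
    simp [LinearMap.sum_apply]
  have e1 : P.gauge ρ x y (P.clifford ρ y Z ψ) =
      ∑ i, (inner ℝ (P.frame (P.indexAt y) i y) Z : ℝ) •
        ρ.act g (ρ.act (clBasis n i) (ψ : S)) := by
    rw [gauge_eq, clifford_apply]
    -- The fibre at `y` is `S` only by unfolding, so rewriting has to work up to definitional
    -- equality.
    erw [map_sum]
    refine Finset.sum_congr rfl fun i _ => ?_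
    erw [map_smul]
    rfl
  have e2 (s : S) : ∑ i, (inner ℝ (P.frame (P.indexAt y) i y) Z : ℝ) •
      ρ.act g (ρ.act (clBasis n i) s) = ∑ j, (inner ℝ (P.frame (P.indexAt x) j y) Z : ℝ) •
        ρ.act (clBasis n j) (ρ.act g s) := by
    simp only [hA, Finset.smul_sum, smul_smul]
    rw [Finset.sum_comm]
    refine Finset.sum_congr rfl fun j _ => ?_
    rw [← Finset.sum_smul, P.sum_inner_mul_inner_frame hyy]
  exact e1.trans (e2 ψ)

/-! ### The Leibniz rule for the spinor connection. -/

variable [IsContMDiffRiemannianBundle (𝓡 n) ∞ (EuclideanSpace ℝ (Fin n))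
  (fun x : M => TangentSpace (𝓡 n) x)]

theorem spinConnection_apply (ψ : (x : M) → P.Spinor ρ x) (x : M) (v : TangentSpace (𝓡 n) x) :
    P.spinConnection ρ ψ x v =
      (mvfderiv (𝓡 n) (fun y => P.gauge ρ x y (ψ y)) x v + P.spinForm ρ x (ψ x) v : S) := rfl

theorem spinForm_apply (x : M) (ψ : S) (v : TangentSpace (𝓡 n) x) :
    P.spinForm ρ x ψ v = (1 / 4 : ℝ) • ∑ j, ∑ k,
      (inner ℝ (P.e k x) (P.leviCivita (P.frame (P.indexAt x) j) x v) : ℝ) •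
        ρ.act (clBasis n j * clBasis n k) ψ := by
  simp [spinForm]

/-- Metric compatibility applied to the constant functions `⟨eⱼ, eₖ⟩`. -/
theorem inner_leviCivita_frame_skew (x : M) (v : TangentSpace (𝓡 n) x) (j k : Fin n) :
    (inner ℝ (P.e k x) (P.leviCivita (P.frame (P.indexAt x) j) x v) : ℝ) =
      -inner ℝ (P.e j x) (P.leviCivita (P.frame (P.indexAt x) k) x v) := by
  have hx := P.mem_baseSet_at x
  have hm := P.leviCivita_isMetricCompatible.mvfderiv_inner_eq
    (extend (EuclideanSpace ℝ (Fin n)) v) (P.mdifferentiableAt_frame hx j)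
    (P.mdifferentiableAt_frame hx k)
  rw [P.mvfderiv_inner_frame hx] at hm
  simp only [extend_apply_self, zero_apply] at hm
  rw [real_inner_comm] at hm
  simp only [e]
  linarith

/-- The product rule for Clifford multiplication. -/
theorem spinConnection_clifford {x : M} {Z : (x : M) → TangentSpace (𝓡 n) x}
    (hZ : MDifferentiableAt (𝓡 n) (𝓡 n).tangent
      (fun y => (⟨y, Z y⟩ : TangentBundle (𝓡 n) M)) x)
    {ψ : (x : M) → P.Spinor ρ x}
    (hψ : MDifferentiableAt (𝓡 n) ((𝓡 n).prod 𝓘(ℝ, S)) (fun x => TotalSpace.mk' S x (ψ x)) x)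
    (v : TangentSpace (𝓡 n) x) :
    P.spinConnection ρ (fun y => P.clifford ρ y (Z y) (ψ y)) x v =
      P.clifford ρ x (P.leviCivita Z x v) (ψ x) +
        P.clifford ρ x (Z x) (P.spinConnection ρ ψ x v) := by
  have hx := P.mem_baseSet_at x
  have hg : MDifferentiableAt (𝓡 n) 𝓘(ℝ, S) (fun y => P.gauge ρ x y (ψ y)) x :=
    (mdifferentiableAt_section (𝓡 n) ψ).mp hψ
  have hactD (j : Fin n) : HasMFDerivAt (𝓡 n) 𝓘(ℝ, S)
      (fun y => ρ.act (clBasis n j) (P.gauge ρ x y (ψ y))) x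
      ((ρ.act (clBasis n j)).comp (mvfderiv (𝓡 n) (fun y => P.gauge ρ x y (ψ y)) x)) :=
    (ρ.act (clBasis n j)).hasMFDerivAt.comp x hg.hasMFDerivAt
  have hact (j : Fin n) : mvfderiv (𝓡 n) (fun y => ρ.act (clBasis n j) (P.gauge ρ x y (ψ y))) x v =
      ρ.act (clBasis n j) (mvfderiv (𝓡 n) (fun y => P.gauge ρ x y (ψ y)) x v) :=
    congr($((hactD j).mfderiv) v)
  have hcoeff (j : Fin n) := P.mdifferentiableAt_coeff hx j hZ
  have hcoeffD (j : Fin n) :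
      mvfderiv (𝓡 n) (fun y => (inner ℝ (P.frame (P.indexAt x) j y) (Z y) : ℝ)) x v =
        inner ℝ (P.leviCivita (P.frame (P.indexAt x) j) x v) (Z x) +
          inner ℝ (P.frame (P.indexAt x) j x) (P.leviCivita Z x v) := by
    simpa using P.leviCivita_isMetricCompatible.mvfderiv_inner_eq
      (extend (EuclideanSpace ℝ (Fin n)) v) (P.mdifferentiableAt_frame hx j) hZ
  -- `clifford` at `y` uses the gauge chosen at `y`; near `x` it is rewritten in the single gauge of
  -- `x`, where it can be differentiated.
  have hEv : (fun y => P.gauge ρ x y (P.clifford ρ y (Z y) (ψ y))) =ᶠ[𝓝 x]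
      fun y => ∑ j, (inner ℝ (P.frame (P.indexAt x) j y) (Z y) : ℝ) •
        ρ.act (clBasis n j) (P.gauge ρ x y (ψ y)) := by
    filter_upwards [(P.isOpen_baseSet _).mem_nhds hx] with y hy using P.gauge_clifford ρ hy _ _
  have hD : mvfderiv (𝓡 n) (fun y => P.gauge ρ x y (P.clifford ρ y (Z y) (ψ y))) x v =
      ∑ j, ((inner ℝ (P.frame (P.indexAt x) j x) (Z x) : ℝ) •
          ρ.act (clBasis n j) (mvfderiv (𝓡 n) (fun y => P.gauge ρ x y (ψ y)) x v) +
        (inner ℝ (P.leviCivita (P.frame (P.indexAt x) j) x v) (Z x) +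
          inner ℝ (P.frame (P.indexAt x) j x) (P.leviCivita Z x v) : ℝ) •
          ρ.act (clBasis n j) (P.gauge ρ x x (ψ x))) := by
    have h1 : mvfderiv (𝓡 n) (fun y => P.gauge ρ x y (P.clifford ρ y (Z y) (ψ y))) x v =
        mvfderiv (𝓡 n) (fun y => ∑ j, (inner ℝ (P.frame (P.indexAt x) j y) (Z y) : ℝ) •
        ρ.act (clBasis n j) (P.gauge ρ x y (ψ y))) x v :=
      congr($(hEv.mfderiv_eq (I := 𝓡 n) (I' := 𝓘(ℝ, S))) v)
    have hsm (j : Fin n) : MDifferentiableAt (𝓡 n) 𝓘(ℝ, S)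
        (fun y => (inner ℝ (P.frame (P.indexAt x) j y) (Z y) : ℝ) •
          ρ.act (clBasis n j) (P.gauge ρ x y (ψ y))) x :=
      (hcoeff j).smul (hactD j).mdifferentiableAt
    rw [h1, mvfderiv_fun_sum _ fun j _ => hsm j, sum_apply]
    refine Finset.sum_congr rfl fun j _ => ?_
    rw [mvfderiv_fun_smul (hcoeff j) (hactD j).mdifferentiableAt, add_apply, smul_apply,
      ContinuousLinearMap.smulRight_apply, hact, hcoeffD]
  have hcl (X : TangentSpace (𝓡 n) x) (χ : P.Spinor ρ x) : P.clifford ρ x X χ =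
      ∑ j, (inner ℝ (P.frame (P.indexAt x) j x) X : ℝ) •
        ρ.act (clBasis n j) (P.gauge ρ x x χ) := by
    rw [← P.gauge_self ρ x (P.clifford ρ x X χ), P.gauge_clifford ρ hx]
  -- Here `A j k = ⟨eₖ, ∇_v eⱼ⟩`, so the commutator contributes `∑ₖ ⟨∇_v eₖ, Z⟩ eₖ · ψ`, exactly the
  -- frame derivative term in `hcoeffD`.
  have hcomm := ρ.act_vector_commutator
    (fun j k => inner ℝ (P.e k x) (P.leviCivita (P.frame (P.indexAt x) j) x v))
    (fun j k => P.inner_leviCivita_frame_skew x v j k)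
    (fun m => inner ℝ (P.frame (P.indexAt x) m x) (Z x)) (P.gauge ρ x x (ψ x))
  have hinner (w : TangentSpace (𝓡 n) x) :
      ∑ m, (inner ℝ (P.frame (P.indexAt x) m x) (Z x) : ℝ) * inner ℝ (P.e m x) w =
        inner ℝ w (Z x) := by
    rw [← P.sum_inner_mul_inner_frame hx (Z x) w]
    exact Finset.sum_congr rfl fun m _ => by rw [real_inner_comm w, e]
  simp only [hinner, ← spinForm_apply] at hcomm
  set G : S := P.gauge ρ x x (ψ x) with hG
  set dG : S := mvfderiv (𝓡 n) (fun y => P.gauge ρ x y (ψ y)) x v with hdG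
  have hGψ : G = ψ x := P.gauge_self ρ x (ψ x)
  have hlhs : P.spinConnection ρ (fun y => P.clifford ρ y (Z y) (ψ y)) x v =
      (∑ j, ((inner ℝ (P.frame (P.indexAt x) j x) (Z x) : ℝ) • ρ.act (clBasis n j) dG +
        (inner ℝ (P.leviCivita (P.frame (P.indexAt x) j) x v) (Z x) +
          inner ℝ (P.frame (P.indexAt x) j x) (P.leviCivita Z x v) : ℝ) •
          ρ.act (clBasis n j) G) + P.spinForm ρ x
        (∑ j, (inner ℝ (P.frame (P.indexAt x) j x) (Z x) : ℝ) • ρ.act (clBasis n j) G) v : S) := by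
    rw [spinConnection_apply, hD, hcl]
  have hψv : P.gauge ρ x x (P.spinConnection ρ ψ x v) = dG + P.spinForm ρ x G v := by
    rw [P.gauge_self, spinConnection_apply, hGψ]
  have hmain : (∑ j, ((inner ℝ (P.frame (P.indexAt x) j x) (Z x) : ℝ) • ρ.act (clBasis n j) dG +
        (inner ℝ (P.leviCivita (P.frame (P.indexAt x) j) x v) (Z x) +
          inner ℝ (P.frame (P.indexAt x) j x) (P.leviCivita Z x v) : ℝ) •
          ρ.act (clBasis n j) G) + P.spinForm ρ x
        (∑ j, (inner ℝ (P.frame (P.indexAt x) j x) (Z x) : ℝ) • ρ.act (clBasis n j) G) v : S) =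
      ∑ j, (inner ℝ (P.frame (P.indexAt x) j x) (P.leviCivita Z x v) : ℝ) •
          ρ.act (clBasis n j) G +
        ∑ j, (inner ℝ (P.frame (P.indexAt x) j x) (Z x) : ℝ) •
          ρ.act (clBasis n j) (dG + P.spinForm ρ x G v) := by
    simp only [map_add, smul_add, add_smul, Finset.sum_add_distrib, hcomm]
    abel
  rw [hlhs, hmain]
  exact (congrArg₂ (fun a b : S => a + b) (hcl (P.leviCivita Z x v) (ψ x))
    ((hcl (Z x) (P.spinConnection ρ ψ x v)).trans (by rw [hψv]))).symm

end SpinStructure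

/-! ### The twisted Dirac operator on the Wang map. -/

namespace SpinStructure

variable {n : ℕ} {M : Type*} [TopologicalSpace M] [ChartedSpace (EuclideanSpace ℝ (Fin n)) M]
  [IsManifold (𝓡 n) ∞ M] [RiemannianBundle (fun x : M => TangentSpace (𝓡 n) x)]
  {ι : Type*} (P : SpinStructure n M ι)
  {S : Type*} [NormedAddCommGroup S] [NormedSpace ℂ S] [FiniteDimensional ℂ S]
  (ρ : SpinorModule n S)
  (h : (x : M) → TangentSpace (𝓡 n) x →L[ℝ] TangentSpace (𝓡 n) x →L[ℝ] ℝ)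
  (φ : (x : M) → P.Spinor ρ x)

theorem wang_apply (h_symm : ∀ x u v, h x u v = h x v u) (x : M) (X : TangentSpace (𝓡 n) x) :
    P.wang h ρ φ x X = P.clifford ρ x (P.sharp h x X) (φ x) := by
  have hs : P.sharp h x X = ∑ j, h x X (P.e j x) • P.e j x :=
    Finset.sum_congr rfl fun j _ => by rw [h_symm]
  rw [hs]
  simp [wang]

variable [IsContMDiffRiemannianBundle (𝓡 n) ∞ (EuclideanSpace ℝ (Fin n))
  (fun x : M => TangentSpace (𝓡 n) x)]

/-- `kappa` omits the diagonal of the double sum, and `div` supplies it: its minus sign is the one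
in `eᵢ · eᵢ · φ = -φ`. -/
theorem four_smul_kappa_add_div_smul (x : M) (X : TangentSpace (𝓡 n) x) :
    (4 : ℝ) • P.kappa h ρ φ x X + P.div h x X • φ x =
      ∑ i, ∑ j, P.nablaBilin h x (P.e i x) X (P.e j x) •
        P.clifford ρ x (P.e i x) (P.clifford ρ x (P.e j x) (φ x)) := by
  have hsq (i : Fin n) : P.clifford ρ x (P.e i x) (P.clifford ρ x (P.e i x) (φ x)) = -φ x := by
    have h2 := P.clifford_anticomm ρ x (P.e i x) (P.e i x) (φ x)
    rw [e, P.inner_frame (P.mem_baseSet_at x), if_pos rfl, ← two_smul ℝ] at h2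
    have h3 : (2 : ℝ) • P.clifford ρ x (P.e i x) (P.clifford ρ x (P.e i x) (φ x)) =
        (2 : ℝ) • -φ x := h2.trans (by module)
    exact smul_right_injective _ (two_ne_zero (α := ℝ)) h3
  rw [kappa, smul_smul, show (4 : ℝ) * (1 / 4) = 1 by norm_num, one_smul, div, neg_smul,
    Finset.sum_smul, ← Finset.sum_neg_distrib, ← Finset.sum_add_distrib]
  refine Finset.sum_congr rfl fun i _ => ?_
  rw [← smul_neg, ← hsq i, ← Finset.sum_erase_add Finset.univ
    (fun j => P.nablaBilin h x (P.e i x) X (P.e j x) •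
        P.clifford ρ x (P.e i x) (P.clifford ρ x (P.e j x) (φ x))) (Finset.mem_univ i)]
  congr 1
  rw [← Finset.sum_filter]
  refine Finset.sum_congr ?_ fun _ _ => rfl
  ext j
  simp [eq_comm]

/-- The Leibniz rule for `h^#(X) · φ`, with `X` extended near `x`. Subtracting `W(∇_v X)` leaves
`(∇_v h^#)(X) · φ`, which is then expanded in the frame. -/
theorem twistedConnection_wang
    (hφ : ContMDiff (𝓡 n) ((𝓡 n).prod 𝓘(ℝ, S)) ∞ (fun x => TotalSpace.mk' S x (φ x)))
    (hh : ContMDiff (𝓡 n) ((𝓡 n).prod 𝓘(ℝ, EuclideanSpace ℝ (Fin n) →L[ℝ]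
        EuclideanSpace ℝ (Fin n) →L[ℝ] ℝ)) ∞
      (fun x => TotalSpace.mk' (EuclideanSpace ℝ (Fin n) →L[ℝ]
        EuclideanSpace ℝ (Fin n) →L[ℝ] ℝ) x (h x)))
    (h_symm : ∀ x u v, h x u v = h x v u) (x : M) (v X : TangentSpace (𝓡 n) x) :
    P.twistedConnection ρ (P.wang h ρ φ) x v X =
      ∑ j, P.nablaBilin h x v X (P.e j x) • P.clifford ρ x (P.e j x) (φ x) +
        P.clifford ρ x (P.sharp h x X) (P.spinConnection ρ φ x v) := by
  have hX := P.mdifferentiableAt_sharp h hh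
    (mdifferentiableAt_extend (𝓡 n) (EuclideanSpace ℝ (Fin n)) X)
  have hB : ∑ j, P.nablaBilin h x v X (P.e j x) • P.clifford ρ x (P.e j x) (φ x) =
      P.clifford ρ x
        (P.leviCivita (fun y => P.sharp h y (extend (EuclideanSpace ℝ (Fin n)) X y)) x v -
          P.sharp h x (P.leviCivita (extend (EuclideanSpace ℝ (Fin n)) X) x v)) (φ x) := by
    simp only [P.nablaBilin_eq_inner h hh h_symm, clifford_e]
    rw [clifford_apply]
    rfl
  rw [hB, twistedConnection]
  simp only [P.wang_apply ρ h φ h_symm]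
  rw [P.spinConnection_clifford ρ hX ((hφ x).mdifferentiableAt (by simp)), extend_apply_self,
    map_sub, sub_apply]
  abel

/-- Anticommuting `eᵢ` with `Z` gives `-2⟨eᵢ, Z⟩ ∇_{eᵢ} φ - Z · eᵢ · ∇_{eᵢ} φ`; linearity of `∇φ` in
the direction collects the first terms into `-2∇_Z φ`. -/
theorem sum_clifford_clifford (x : M) (Z : TangentSpace (𝓡 n) x) :
    ∑ i, P.clifford ρ x (P.e i x) (P.clifford ρ x Z (P.spinConnection ρ φ x (P.e i x))) =
      -((2 : ℝ) • P.spinConnection ρ φ x Z) - P.clifford ρ x Z (P.dirac ρ φ x) := by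
  have hZ : P.spinConnection ρ φ x Z =
      ∑ i, (inner ℝ (P.e i x) Z : ℝ) • P.spinConnection ρ φ x (P.e i x) := by
    conv_lhs => rw [← P.sum_inner_frame (P.mem_baseSet_at x) Z]
    simp only [map_sum, map_smul, e]
  rw [hZ, dirac, map_sum, Finset.smul_sum, ← Finset.sum_neg_distrib, ← Finset.sum_sub_distrib]
  refine Finset.sum_congr rfl fun i _ => ?_
  rw [eq_sub_iff_add_eq, clifford_anticomm]
  module

end SpinStructure

end SpinGeometry

theorem lemma3p1 {n : ℕ} {M : Type*} [TopologicalSpace M]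
    [ChartedSpace (EuclideanSpace ℝ (Fin n)) M] [IsManifold (𝓡 n) ∞ M]
    [RiemannianBundle (fun x : M => TangentSpace (𝓡 n) x)]
    [IsContMDiffRiemannianBundle (𝓡 n) ∞ (EuclideanSpace ℝ (Fin n))
      (fun x : M => TangentSpace (𝓡 n) x)]
    {ι : Type*} (P : SpinGeometry.SpinStructure n M ι)
    {S : Type*} [NormedAddCommGroup S] [NormedSpace ℂ S] [FiniteDimensional ℂ S]
    (ρ : SpinGeometry.SpinorModule n S)
    (φ : (x : M) → P.Spinor ρ x)
    (hφ : ContMDiff (𝓡 n) ((𝓡 n).prod 𝓘(ℝ, S)) ∞ (fun x => TotalSpace.mk' S x (φ x)))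
    (h : (x : M) → TangentSpace (𝓡 n) x →L[ℝ] TangentSpace (𝓡 n) x →L[ℝ] ℝ)
    (hh : ContMDiff (𝓡 n) ((𝓡 n).prod 𝓘(ℝ, EuclideanSpace ℝ (Fin n) →L[ℝ]
        EuclideanSpace ℝ (Fin n) →L[ℝ] ℝ)) ∞
      (fun x => TotalSpace.mk' (EuclideanSpace ℝ (Fin n) →L[ℝ]
        EuclideanSpace ℝ (Fin n) →L[ℝ] ℝ) x (h x)))
    (h_symm : ∀ x u v, h x u v = h x v u) :
    (∀ (x : M) (X : TangentSpace (𝓡 n) x),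
      P.twistedDirac ρ (P.wang h ρ φ) x X =
        (4 : ℝ) • P.kappa h ρ φ x X + P.div h x X • φ x
          - (2 : ℝ) • P.spinConnection ρ φ x (P.sharp h x X)
          - P.clifford ρ x (P.sharp h x X) (P.dirac ρ φ x)) ∧
    ((∀ (x : M) (v : TangentSpace (𝓡 n) x), P.spinConnection ρ φ x v = 0) →
      ∀ (x : M) (X : TangentSpace (𝓡 n) x),
        P.twistedDirac ρ (P.wang h ρ φ) x X =
          (4 : ℝ) • P.kappa h ρ φ x X + P.div h x X • φ x) := by
  have formula (x : M) (X : TangentSpace (𝓡 n) x) :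
      P.twistedDirac ρ (P.wang h ρ φ) x X =
        (4 : ℝ) • P.kappa h ρ φ x X + P.div h x X • φ x
          - (2 : ℝ) • P.spinConnection ρ φ x (P.sharp h x X)
          - P.clifford ρ x (P.sharp h x X) (P.dirac ρ φ x) := by
    rw [P.four_smul_kappa_add_div_smul, SpinGeometry.SpinStructure.twistedDirac]
    simp only [P.twistedConnection_wang ρ h φ hφ hh h_symm, map_add, map_sum, map_smul,
      Finset.sum_add_distrib]
    rw [P.sum_clifford_clifford]
    abel
  refine ⟨formula, fun hpar x X => ?_⟩
  have hD : P.dirac ρ φ x = 0 := by simp [SpinGeometry.SpinStructure.dirac, hpar]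
  rw [formula, hpar, hD]
  simp
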